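/- Notation. For $C>1$, $\delta\in(0,1]$, $\rho\in[0,1]$ and $\nu\in[\delta,1]$, with natural logarithms throughout, let $H(p)=p\log\frac1p+(1-p)\log\frac1{1-p}$ and $$\psi_{com}(\nu;\rho,\delta)=\nu\log 2+H(\rho\delta)+(1-\rho\delta)\,H\!\Big(\frac{\nu-\rho\delta}{1-\rho\delta}\Big).$$ Let $g(x)=\frac{2}{\sqrt\pi}e^{-x^2}$, $G(x)=\frac{2}{\sqrt\pi}\int_0^x e^{-y^2}\,dy$, $\nu'=(C^2-1)\rho\delta+\nu$, let $x_\nu\ge 0$ be the unique nonnegative solution of $\frac{2xG(x)}{g(x)}=\frac{1-\nu}{\nu'}$, and put $$\psi_{ext}(\nu;\rho,\delta)=-(1-\nu)\log G(x_\nu)+\nu x_\nu^2\qquad(\psi_{ext}(1;\rho,\delta)=0).$$ Let $\Lambda(s)=\log\mathbb E\,e^{s|Z|}$ with $Z\sim N(0,1)$, $\Lambda^*(y)=\max_{s\in\mathbb R}\,(sy-\Lambda(s))$ for $y>0$, $\xi_{\gamma}(y)=\frac{1-\gamma}{\gamma}\frac{y^2}{2}+\Lambda^*(y)$ for $y>0$,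 let $y_\gamma$ be the unique minimizer of $\xi_\gamma$ on $(0,\infty)$, and put $$\gamma'=\frac{\rho\delta}{\frac{C^2-1}{C^2}\rho\delta+\frac{\nu}{C^2}},\qquad \psi_{int}(\nu;\rho,\delta)=\big(\xi_{\gamma'}(y_{\gamma'})+\log 2\big)(\nu-\rho\delta).$$ Let $\psi_{net}=\psi_{com}-\psi_{int}-\psi_{ext}$, and let $\rho_N(\delta,C)$ be the supremum of all $\rho\in[0,1]$ such that $\psi_{net}(\nu;\rho,\delta)<0$ for all $\nu\in[\delta,1]$ (the supremum of the empty set being $0$). Lemma 5. For every $\eta>0$ and every $C>1$ there is $\delta_0>0$ such that for all $\delta\in(0,\delta_0)$ $$\rho_N(\delta,C)\ \ge\ \Big(\log\frac1\delta\Big)^{-(1+\eta)}.$$ The same holds when the term $\nu x_\nu^2$ in $\psi_{ext}$ is replaced by $\nu' x_\nu^2$, that is, when $\psi_{ext}(\nu;\rho,\delta)=\min_{x>0}\big(\nu' x^2-(1-\nu)\log G(x)\big)$ for $\nu<1$. -/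

import Mathlib

open Set Filter Topology MeasureTheory ProbabilityTheory

namespace NetExponent

noncomputable section

/-- The binary entropy in nats, `H(p) = p log(1/p) + (1-p) log(1/(1-p))`. -/
def H (p : ℝ) : ℝ := Real.binEntropy p

/-- The combinatorial growth exponent `ψ_com(ν; ρ, δ)`. -/
def psiCom (ρ δ ν : ℝ) : ℝ :=
  ν * Real.log 2 + H (ρ * δ) + H ((ν - ρ * δ) / (1 - ρ * δ)) * (1 - ρ * δ)

/-! External angle exponent. -/

/-- The density of the half-normal law `HN(0, 1/2)` on `[0, ∞)`. -/
def g (x : ℝ) : ℝ := 2 / √Real.pi * Real.exp (-x ^ 2)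

/-- The distribution function of `HN(0, 1/2)` on `[0, ∞)`, i.e. the error function. -/
def G (x : ℝ) : ℝ := 2 / √Real.pi * ∫ y in (0 : ℝ)..x, Real.exp (-y ^ 2)

/-- `ν' = (C² - 1) ρ δ + ν`. -/
def nuPrime (C ρ δ ν : ℝ) : ℝ := (C ^ 2 - 1) * ρ * δ + ν

/-- `x_ν`: the solution `x ≥ 0` of `2 x G(x) / g(x) = (1 - ν) / ν'`. The left side increases strictly
from `0` to `∞` on `[0, ∞)`, so for `0 < ν ≤ 1` the set below has exactly one element. -/
def xNu (C ρ δ ν : ℝ) : ℝ :=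
  sInf {x : ℝ | 0 ≤ x ∧ 2 * x * G x / g x = (1 - ν) / nuPrime C ρ δ ν}

/-- The external exponent with the quadratic term `ν x_ν²`. At `ν = 1` one has `x_ν = 0` and the
first term is `0 * log 0 = 0`. -/
def psiExt (C ρ δ ν : ℝ) : ℝ :=
  -(1 - ν) * Real.log (G (xNu C ρ δ ν)) + ν * xNu C ρ δ ν ^ 2

/-- The external exponent with the quadratic term `ν' x_ν²`, which is the value at `x = x_ν` of
`ν' x² - (1 - ν) log G(x)`, the function minimized by `x_ν`. -/
def psiExtMin (C ρ δ ν : ℝ) : ℝ :=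
  -(1 - ν) * Real.log (G (xNu C ρ δ ν)) + nuPrime C ρ δ ν * xNu C ρ δ ν ^ 2

/-! Internal angle exponent. -/

/-- The cumulant generating function `Λ(s) = log E exp(sY)` of `Y = |Z|`, `Z ∼ N(0, 1)`. -/
def cumulant (s : ℝ) : ℝ := cgf (fun z : ℝ => |z|) (gaussianReal 0 1) s

/-- The rate function `Λ*(y) = max_s (s y - Λ(s))`; only its values at `y > 0`, where the maximum is
attained, are used. -/
def rate (y : ℝ) : ℝ := ⨆ s : ℝ, (s * y - cumulant s)

/-- `ξ_γ(y) = ((1 - γ) / γ) y² / 2 + Λ*(y)`, for `y > 0`. -/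
def xi (γ y : ℝ) : ℝ := (1 - γ) / γ * (y ^ 2 / 2) + rate y

/-- `y_γ`: the (unique) minimizer of `ξ_γ` on `(0, ∞)`. -/
def yMin (γ : ℝ) : ℝ := sInf {y : ℝ | 0 < y ∧ IsMinOn (xi γ) (Ioi 0) y}

/-- `γ' = ρ δ / (((C² - 1) / C²) ρ δ + ν / C²)`. -/
def gammaPrime (C ρ δ ν : ℝ) : ℝ :=
  ρ * δ / ((C ^ 2 - 1) / C ^ 2 * (ρ * δ) + ν / C ^ 2)

/-- The internal exponent `ψ_int(ν; ρ, δ) = (ξ_{γ'}(y_{γ'}) + log 2) (ν - ρ δ)`. -/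
def psiInt (C ρ δ ν : ℝ) : ℝ :=
  xi (gammaPrime C ρ δ ν) (yMin (gammaPrime C ρ δ ν)) * (ν - ρ * δ)
    + Real.log 2 * (ν - ρ * δ)

/-! Net exponent and critical proportion. -/

/-- The net exponent `ψ_com - ψ_int - ψ_ext`, formed with a given external exponent
`ext` (a function of `C, ρ, δ, ν`). -/
def psiNet (ext : ℝ → ℝ → ℝ → ℝ → ℝ) (C ρ δ ν : ℝ) : ℝ :=
  psiCom ρ δ ν - psiInt C ρ δ ν - ext C ρ δ ν

/-- The critical proportion `ρ_N(δ, C)`: the supremum of the `ρ ∈ [0, 1]` with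
`ψ_net(ν; ρ, δ) < 0` for all `ν ∈ [δ, 1]`. Whether `ρ = 0` satisfies the condition has no influence on
the value, because the supremum of the empty set of reals is `0`. -/
def rhoN (ext : ℝ → ℝ → ℝ → ℝ → ℝ) (δ C : ℝ) : ℝ :=
  sSup {ρ : ℝ | ρ ∈ Icc (0 : ℝ) 1 ∧ ∀ ν ∈ Icc δ 1, psiNet ext C ρ δ ν < 0}

end

end NetExponent

namespace NetExponent

/-! ### The external exponent -/

/-! Write ℓ = log(1/δ), take ρ = ℓ^(-(1+η)), and compare the three exponents per unit of ν,
uniformly on [δ, 1]. The combinatorial exponent is at most ν log(1/ν) + 5ν (`psiCom_upper_bound`).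
The external one cancels this entropy up to a factor polynomial in ℓ inside the logarithm: x_ν² is
at least log(1/ν) - (log ℓ)/2 - const (`xNu_sq_lower_bound`). The internal one contributes at least
ν (log(1/ρ)/2 - const), because the density of |Z| is bounded near 0, so that Λ*(y) ≥ -log y - 1
(`psiInt_ge_of_two_mul_le_one`). Hence ψ_net/ν ≤ const + (log ℓ)/2 - log(1/ρ)/2 = const - (η/2) log
ℓ, which is negative for small δ. Replacing ν by ν' ≥ ν only enlarges the external exponent. -/

lemma continuous_G : Continuous G := by
  unfold G
  exact continuous_const.mul
    (intervalIntegral.continuous_primitive (fun a b => (by fun_prop :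
      Continuous fun y : ℝ => Real.exp (-y ^ 2)).intervalIntegrable a b) 0)

lemma g_pos (x : ℝ) : 0 < g x := by
  unfold g
  have := Real.pi_pos
  positivity

lemma continuous_g : Continuous g := by
  unfold g
  fun_prop

lemma G_zero : G 0 = 0 := by simp [G]

lemma integrable_exp_neg_sq : Integrable fun y : ℝ => Real.exp (-y ^ 2) := by
  simpa using integrable_exp_neg_mul_sq (b := 1) one_pos

lemma monotone_G : Monotone G := by
  intro a b hab
  unfold G
  refine mul_le_mul_of_nonneg_left ?_ (by positivity)
  rw [← sub_nonneg, intervalIntegral.integral_interval_sub_left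
    integrable_exp_neg_sq.intervalIntegrable integrable_exp_neg_sq.intervalIntegrable]
  exact intervalIntegral.integral_nonneg hab fun _ _ => (Real.exp_pos _).le

lemma G_nonneg {x : ℝ} (hx : 0 ≤ x) : 0 ≤ G x := G_zero ▸ monotone_G hx

lemma G_one_pos : 0 < G 1 := by
  unfold G
  have := Real.pi_pos
  refine mul_pos (by positivity) ?_
  exact intervalIntegral.intervalIntegral_pos_of_pos
    integrable_exp_neg_sq.intervalIntegrable (fun _ => Real.exp_pos _) one_pos

lemma G_le_one {x : ℝ} (hx : 0 ≤ x) : G x ≤ 1 := by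
  have hpi : 0 < √Real.pi := Real.sqrt_pos.2 Real.pi_pos
  have h : ∫ y in (0 : ℝ)..x, Real.exp (-y ^ 2) ≤ √Real.pi / 2 := by
    have hI := integral_gaussian_Ioi 1
    simp only [neg_mul, one_mul, div_one] at hI
    rw [← hI, intervalIntegral.integral_of_le hx]
    exact setIntegral_mono_set integrable_exp_neg_sq.integrableOn
      (ae_of_all _ fun _ => (Real.exp_pos _).le) (Ioc_subset_Ioi_self).eventuallyLE
  unfold G
  calc 2 / √Real.pi * ∫ y in (0 : ℝ)..x, Real.exp (-y ^ 2)
      ≤ 2 / √Real.pi * (√Real.pi / 2) := mul_le_mul_of_nonneg_left h (by positivity)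
    _ = 1 := by field_simp

lemma continuous_two_mul_mul_G_div_g : Continuous fun x => 2 * x * G x / g x :=
  ((continuous_const.mul continuous_id).mul continuous_G).div continuous_g fun x => (g_pos x).ne'

lemma two_mul_mul_G_div_g (x : ℝ) :
    2 * x * G x / g x = √Real.pi * x * G x * Real.exp (x ^ 2) := by
  have hpi : 0 < √Real.pi := Real.sqrt_pos.2 Real.pi_pos
  unfold g
  rw [Real.exp_neg]
  field_simp

lemma one_le_sqrt_pi : 1 ≤ √Real.pi :=
  Real.one_le_sqrt.2 (by linarith [Real.pi_gt_three])

lemma exists_two_mul_mul_G_div_g_eq {r : ℝ} (hr : 0 ≤ r) :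
    ∃ x, 0 ≤ x ∧ 2 * x * G x / g x = r := by
  -- For b ≥ 1 the left side at b is at least b G(1), since √π exp(b²) ≥ 1.
  set b : ℝ := max 1 (r / G 1) with hb
  have hb1 : 1 ≤ b := le_max_left _ _
  have hbr : r ≤ 2 * b * G b / g b := by
    rw [two_mul_mul_G_div_g]
    have h1 : r ≤ b * G 1 := (div_le_iff₀ G_one_pos).1 (le_max_right _ _)
    have h2 : b * G 1 ≤ b * G b := mul_le_mul_of_nonneg_left (monotone_G hb1) (by linarith)
    have h3 : 0 ≤ b * G b := mul_nonneg (by linarith) (G_nonneg (by linarith))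
    have h4 : 1 ≤ √Real.pi * Real.exp (b ^ 2) :=
      one_le_mul_of_one_le_of_one_le one_le_sqrt_pi (Real.one_le_exp (sq_nonneg b))
    calc r ≤ b * G b := h1.trans h2
      _ ≤ b * G b * (√Real.pi * Real.exp (b ^ 2)) := le_mul_of_one_le_right h3 h4
      _ = _ := by ring
  obtain ⟨x, hx, hxr⟩ := intermediate_value_Icc (zero_le_one.trans hb1)
    continuous_two_mul_mul_G_div_g.continuousOn (show r ∈ Icc _ _ from ⟨by simpa using hr, hbr⟩)
  exact ⟨x, hx.1, hxr⟩

lemma xNu_spec {C ρ δ ν : ℝ} (h : 0 ≤ (1 - ν) / nuPrime C ρ δ ν) :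
    0 ≤ xNu C ρ δ ν ∧
      2 * xNu C ρ δ ν * G (xNu C ρ δ ν) / g (xNu C ρ δ ν) = (1 - ν) / nuPrime C ρ δ ν := by
  have hclosed : IsClosed {x : ℝ | 0 ≤ x ∧ 2 * x * G x / g x = (1 - ν) / nuPrime C ρ δ ν} :=
    (isClosed_le continuous_const continuous_id).inter
      (isClosed_eq continuous_two_mul_mul_G_div_g continuous_const)
  exact hclosed.csInf_mem (exists_two_mul_mul_G_div_g_eq h) ⟨0, fun _ hx => hx.1⟩

/-- A lower bound for the solution of `√π x G(x) exp(x²) = r` in terms of a lower bound for `r`. -/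
lemma sq_lower_bound {x t B ℓ : ℝ} (hx : 0 ≤ x) (hB : 0 < B) (ht : t ≤ ℓ) (hℓ : 1 ≤ ℓ)
    (h : Real.exp t ≤ B * x * Real.exp (x ^ 2)) :
    t - Real.log ℓ / 2 - max (Real.log B) 0 ≤ x ^ 2 := by
  have hlogℓ : 0 ≤ Real.log ℓ := Real.log_nonneg hℓ
  rcases le_total t (x ^ 2) with h1 | h1
  · linarith [le_max_right (Real.log B) 0]
  -- Here x² ≤ t ≤ ℓ, so log x costs at most (log ℓ)/2 after taking logarithms.
  · have hx0 : 0 < x := by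
      rcases hx.eq_or_lt with h0 | h0
      · rw [← h0] at h
        simp only [mul_zero, zero_mul] at h
        exact absurd h (not_le.2 (Real.exp_pos t))
      · exact h0
    have h2 : t ≤ Real.log B + Real.log x + x ^ 2 := by
      have := Real.log_le_log (Real.exp_pos t) h
      rwa [Real.log_exp, Real.log_mul (by positivity) (by positivity),
        Real.log_mul hB.ne' hx0.ne', Real.log_exp] at this
    have h3 : 2 * Real.log x ≤ Real.log ℓ := by
      have := Real.log_le_log (by positivity) (h1.trans ht)
      simpa using this
    linarith [le_max_left (Real.log B) 0]

lemma xNu_sq_lower_bound {C ρ δ ν ℓ : ℝ} (hC : 1 < C) (hδ : 0 < δ) (hρ0 : 0 ≤ ρ) (hρ : ρ ≤ 1)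
    (hν : ν ∈ Icc δ 1) (hℓ : 1 ≤ ℓ) (hνℓ : -Real.log ν ≤ ℓ) :
    -Real.log ν - Real.log ℓ / 2 - Real.log (2 * √Real.pi * C ^ 2) ≤ xNu C ρ δ ν ^ 2 := by
  have hν0 : 0 < ν := hδ.trans_le hν.1
  have hC2 : 1 < C ^ 2 := one_lt_pow₀ hC two_ne_zero
  have hkν : ρ * δ ≤ ν := (mul_le_of_le_one_left hδ.le hρ).trans hν.1
  have hk0 : 0 ≤ ρ * δ := mul_nonneg hρ0 hδ.le
  have hnu0 : 0 < nuPrime C ρ δ ν := by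
    unfold nuPrime
    nlinarith [mul_nonneg (sub_nonneg.2 hC2.le) hk0]
  have hnu : nuPrime C ρ δ ν ≤ C ^ 2 * ν := by
    unfold nuPrime
    nlinarith [mul_le_mul_of_nonneg_left hkν (sub_nonneg.2 hC2.le)]
  obtain ⟨hx, hxe⟩ := xNu_spec (C := C) (ρ := ρ) (δ := δ) (ν := ν)
    (div_nonneg (sub_nonneg.2 hν.2) hnu0.le)
  set x := xNu C ρ δ ν
  have hB : 2 ≤ 2 * √Real.pi * C ^ 2 := by
    have : 1 ≤ √Real.pi * C ^ 2 := one_le_mul_of_one_le_of_one_le one_le_sqrt_pi hC2.le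
    linarith
  have hlogB : Real.log 2 ≤ Real.log (2 * √Real.pi * C ^ 2) := Real.log_le_log two_pos hB
  -- For ν ≤ 1/2, 1 - ν ≥ 1/2 accounts for the factor 2 in the constant; for ν ≥ 1/2 the claimed
  -- bound is nonpositive.
  rcases le_total ν (1 / 2) with hhalf | hhalf
  · have key : Real.exp (-Real.log ν) ≤ (2 * √Real.pi * C ^ 2) * x * Real.exp (x ^ 2) := by
      rw [Real.exp_neg, Real.exp_log hν0, inv_eq_one_div, div_le_iff₀ hν0]
      rw [two_mul_mul_G_div_g, eq_div_iff hnu0.ne'] at hxe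
      have hA : 0 ≤ √Real.pi * x * Real.exp (x ^ 2) := by positivity
      have h1 : √Real.pi * x * G x * Real.exp (x ^ 2) ≤ √Real.pi * x * Real.exp (x ^ 2) := by
        nlinarith [mul_le_mul_of_nonneg_left (G_le_one hx) hA]
      have h2 : 1 - ν ≤ √Real.pi * x * Real.exp (x ^ 2) * (C ^ 2 * ν) := by
        rw [← hxe]
        exact mul_le_mul h1 hnu hnu0.le hA
      linarith
    have := sq_lower_bound hx (by linarith) hνℓ hℓ key
    rwa [max_eq_left ((Real.log_nonneg one_le_two).trans hlogB)] at this
  · have h1 : -Real.log ν ≤ Real.log 2 := by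
      rw [← Real.log_inv]
      exact Real.log_le_log (by positivity) (by
        rw [inv_le_comm₀ hν0 two_pos]
        linarith)
    linarith [sq_nonneg x, Real.log_nonneg hℓ]

lemma psiExt_lower_bound {C ρ δ ν ℓ : ℝ} (hC : 1 < C) (hδ : 0 < δ) (hρ0 : 0 ≤ ρ) (hρ : ρ ≤ 1)
    (hν : ν ∈ Icc δ 1) (hℓ : 1 ≤ ℓ) (hνℓ : -Real.log ν ≤ ℓ) :
    ν * (-Real.log ν - Real.log ℓ / 2 - Real.log (2 * √Real.pi * C ^ 2)) ≤ psiExt C ρ δ ν := by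
  have hν0 : 0 < ν := hδ.trans_le hν.1
  have hC2 : 1 < C ^ 2 := one_lt_pow₀ hC two_ne_zero
  have hnu0 : 0 ≤ nuPrime C ρ δ ν := by
    unfold nuPrime
    rw [mul_assoc]
    have := mul_nonneg (sub_nonneg.2 hC2.le) (mul_nonneg hρ0 hδ.le)
    linarith
  have hx := (xNu_spec (C := C) (ρ := ρ) (δ := δ) (ν := ν)
    (div_nonneg (sub_nonneg.2 hν.2) hnu0)).1
  have hlog := Real.log_nonpos (G_nonneg hx) (G_le_one hx)
  have h1 := mul_le_mul_of_nonneg_left (xNu_sq_lower_bound hC hδ hρ0 hρ hν hℓ hνℓ) hν0.le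
  unfold psiExt
  nlinarith [mul_nonneg (sub_nonneg.2 hν.2) (neg_nonneg.2 hlog)]

lemma psiExt_le_psiExtMin {C ρ δ ν : ℝ} (hC : 1 < C) (hδ : 0 ≤ δ) (hρ : 0 ≤ ρ) :
    psiExt C ρ δ ν ≤ psiExtMin C ρ δ ν := by
  have hC2 : 1 < C ^ 2 := one_lt_pow₀ hC two_ne_zero
  have h : ν ≤ nuPrime C ρ δ ν := by
    unfold nuPrime
    rw [mul_assoc]
    have := mul_nonneg (sub_nonneg.2 hC2.le) (mul_nonneg hρ hδ)
    linarith
  unfold psiExt psiExtMin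
  gcongr

/-! ### The internal exponent -/

lemma integrable_exp_mul_abs_gaussianReal (t : ℝ) :
    Integrable (fun z : ℝ => Real.exp (t * |z|)) (gaussianReal 0 1) :=
  integrable_exp_mul_abs (X := fun z : ℝ => z) (integrable_exp_mul_gaussianReal t)
    (integrable_exp_mul_gaussianReal (-t))

lemma integral_exp_neg_mul_abs {t : ℝ} (ht : 0 < t) :
    ∫ z : ℝ, Real.exp (-t * |z|) = 2 / t := by
  rw [integral_comp_abs (f := fun z => Real.exp (-t * z)), integral_exp_mul_Ioi (by linarith)]
  simp
  ring

lemma integrable_exp_neg_mul_abs {t : ℝ} (ht : 0 < t) :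
    Integrable fun z : ℝ => Real.exp (-t * |z|) := by
  -- A non-integrable function would have integral 0 by convention, not 2/t.
  by_contra h
  have h1 := integral_exp_neg_mul_abs ht
  rw [integral_undef h] at h1
  have : 0 < 2 / t := by positivity
  linarith

lemma gaussianPDFReal_zero_one_le_half (z : ℝ) : gaussianPDFReal 0 1 z ≤ 1 / 2 := by
  rw [gaussianPDFReal_def]
  have h2 : 2 ≤ √(2 * Real.pi) := Real.le_sqrt_of_sq_le (by linarith [Real.pi_gt_three])
  have h3 : (√(2 * Real.pi))⁻¹ ≤ 1 / 2 := by
    rw [one_div]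
    exact inv_anti₀ two_pos h2
  have h4 : Real.exp (-(z - 0) ^ 2 / (2 * ((1 : NNReal) : ℝ))) ≤ 1 := by
    rw [Real.exp_le_one_iff, NNReal.coe_one]
    nlinarith [sq_nonneg (z - 0)]
  simp only [NNReal.coe_one, mul_one] at h4 ⊢
  calc _ ≤ (√(2 * Real.pi))⁻¹ * 1 := mul_le_mul_of_nonneg_left h4 (by positivity)
    _ ≤ 1 / 2 := by linarith

lemma cumulant_neg_le {t : ℝ} (ht : 0 < t) : cumulant (-t) ≤ -Real.log t := by
  unfold cumulant cgf
  rw [← Real.log_inv]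
  refine Real.log_le_log (mgf_pos (integrable_exp_mul_abs_gaussianReal (-t))) ?_
  unfold mgf
  rw [integral_gaussianReal_eq_integral_smul one_ne_zero]
  calc ∫ z, gaussianPDFReal 0 1 z • Real.exp (-t * |z|)
      ≤ ∫ z : ℝ, 1 / 2 * Real.exp (-t * |z|) := by
        refine integral_mono_of_nonneg (ae_of_all _ fun z => ?_)
          ((integrable_exp_neg_mul_abs ht).const_mul _) (ae_of_all _ fun z => ?_)
        · exact mul_nonneg (gaussianPDFReal_nonneg _ _ _) (Real.exp_pos _).le
        · exact mul_le_mul_of_nonneg_right (gaussianPDFReal_zero_one_le_half z) (Real.exp_pos _).le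
    _ = t⁻¹ := by
        rw [integral_const_mul, integral_exp_neg_mul_abs ht]
        field_simp

lemma gaussianReal_real_pos {s u : Set ℝ} (hu : IsOpen u) (hne : u.Nonempty) (hus : u ⊆ s) :
    0 < (gaussianReal 0 1).real s := by
  refine ENNReal.toReal_pos (fun h0 => ?_) (measure_ne_top _ _)
  have h1 : volume u = 0 :=
    gaussianReal_absolutelyContinuous' 0 one_ne_zero (measure_mono_null hus h0)
  exact (hu.measure_pos volume hne).ne' h1

/-- Chernoff bounds for the upper tail (s ≥ 0) and the lower tail (s ≤ 0), both events having
positive probability. Without boundedness the supremum in `rate` would carry no information. -/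
lemma bddAbove_range_mul_sub_cumulant {y : ℝ} (hy : 0 < y) :
    BddAbove (range fun s : ℝ => s * y - cumulant s) := by
  have hge : 0 < (gaussianReal 0 1).real {z : ℝ | y ≤ |z|} :=
    gaussianReal_real_pos isOpen_Ioi nonempty_Ioi fun z (hz : y < z) => hz.le.trans (le_abs_self z)
  have hle : 0 < (gaussianReal 0 1).real {z : ℝ | |z| ≤ y} :=
    gaussianReal_real_pos isOpen_Ioo (nonempty_Ioo.2 (neg_lt_self hy))
      fun z (hz : z ∈ Ioo (-y) y) => abs_le.2 ⟨hz.1.le, hz.2.le⟩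
  refine ⟨max (-Real.log ((gaussianReal 0 1).real {z : ℝ | y ≤ |z|}))
    (-Real.log ((gaussianReal 0 1).real {z : ℝ | |z| ≤ y})), ?_⟩
  rintro _ ⟨s, rfl⟩
  have hint := integrable_exp_mul_abs_gaussianReal s
  rcases le_total 0 s with hs | hs
  · refine le_max_of_le_left ?_
    have := Real.log_le_log hge (measure_ge_le_exp_cgf y hs hint)
    rw [Real.log_exp] at this
    change s * y - cgf (fun z : ℝ => |z|) (gaussianReal 0 1) s ≤ _
    linarith
  · refine le_max_of_le_right ?_
    have := Real.log_le_log hle (measure_le_le_exp_cgf y hs hint)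
    rw [Real.log_exp] at this
    change s * y - cgf (fun z : ℝ => |z|) (gaussianReal 0 1) s ≤ _
    linarith

lemma neg_log_sub_one_le_rate {y : ℝ} (hy : 0 < y) : -Real.log y - 1 ≤ rate y := by
  -- The choice s = -1/y maximizes s y + log(-s), the lower bound given by `cumulant_neg_le`.
  have h1 := le_ciSup (bddAbove_range_mul_sub_cumulant hy) (-y⁻¹)
  have h2 := cumulant_neg_le (inv_pos.2 hy)
  have h3 : -y⁻¹ * y = -1 := by field_simp
  rw [Real.log_inv] at h2
  change _ ≤ rate y at h1
  simp only [h3] at h1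
  linarith

lemma lowerSemicontinuousOn_xi (γ : ℝ) : LowerSemicontinuousOn (xi γ) (Ioi 0) := by
  unfold xi rate
  refine LowerSemicontinuousOn.add
    ((show Continuous fun y : ℝ => (1 - γ) / γ * (y ^ 2 / 2) by
      fun_prop).lowerSemicontinuous.lowerSemicontinuousOn _)
    (lowerSemicontinuousOn_ciSup (fun y hy => bddAbove_range_mul_sub_cumulant hy) fun s => ?_)
  exact (show Continuous fun y : ℝ => s * y - cumulant s by fun_prop).lowerSemicontinuous
    |>.lowerSemicontinuousOn _

lemma half_add_log_div_two_le {a y : ℝ} (ha : 0 < a) (hy : 0 < y) :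
    1 / 2 + Real.log a / 2 ≤ a * (y ^ 2 / 2) - Real.log y := by
  have h := Real.log_le_sub_one_of_pos (show 0 < a * y ^ 2 by positivity)
  rw [Real.log_mul ha.ne' (by positivity), Real.log_pow] at h
  push_cast at h
  linarith

lemma xi_lower_bound {γ y : ℝ} (hγ : 0 < (1 - γ) / γ) (hy : 0 < y) :
    Real.log ((1 - γ) / γ) / 2 - 1 / 2 ≤ xi γ y := by
  have h1 := neg_log_sub_one_le_rate hy
  have h2 := half_add_log_div_two_le hγ hy
  unfold xi
  linarith

lemma neg_log_sub_one_le_xi {γ y : ℝ} (hγ : 0 < (1 - γ) / γ) (hy : 0 < y) :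
    -Real.log y - 1 ≤ xi γ y := by
  have h1 := neg_log_sub_one_le_rate hy
  have h2 : 0 ≤ (1 - γ) / γ * (y ^ 2 / 2) := by positivity
  unfold xi
  linarith

lemma exp_le_of_xi_le {γ y M : ℝ} (hγ : 0 < (1 - γ) / γ) (hy : 0 < y) (h : xi γ y ≤ M) :
    Real.exp (-M - 1) ≤ y := by
  rw [← Real.le_log_iff_exp_le hy]
  linarith [neg_log_sub_one_le_xi hγ hy]

lemma exists_bound_of_xi_le {γ : ℝ} (hγ : 0 < (1 - γ) / γ) (M : ℝ) :
    ∃ R, ∀ y, 0 < y → xi γ y ≤ M → y ≤ R := by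
  set a := (1 - γ) / γ with ha
  refine ⟨max 1 (4 / a * (M + 1 / 2 - Real.log (a / 2) / 2)), fun y hy h => ?_⟩
  rcases le_total y 1 with h1 | h1
  · exact le_max_of_le_left h1
  · refine le_max_of_le_right ?_
    -- Half of the quadratic term absorbs -log y; the other half, at least a y / 4 for y ≥ 1, bounds
    -- y.
    have h2 := half_add_log_div_two_le (half_pos hγ) hy
    have h3 := neg_log_sub_one_le_rate hy
    have h4 : a * (y ^ 2 / 2) + rate y ≤ M := h
    have h5 : a / 4 * y ≤ M + 1 / 2 - Real.log (a / 2) / 2 := by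
      nlinarith [mul_le_mul_of_nonneg_left h1 (mul_nonneg hγ.le hy.le)]
    calc y = 4 / a * (a / 4 * y) := by field_simp
      _ ≤ _ := mul_le_mul_of_nonneg_left h5 (by positivity)

lemma exists_isMinOn_xi {γ : ℝ} (hγ : 0 < (1 - γ) / γ) :
    ∃ y, 0 < y ∧ IsMinOn (xi γ) (Ioi 0) y := by
  obtain ⟨R, hR⟩ := exists_bound_of_xi_le hγ (xi γ 1)
  set ε := Real.exp (-xi γ 1 - 1)
  have hε : 0 < ε := Real.exp_pos _
  have hsub : Icc ε R ⊆ Ioi 0 := fun y hy => hε.trans_le hy.1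
  have h1 : (1 : ℝ) ∈ Icc ε R := ⟨exp_le_of_xi_le hγ one_pos le_rfl, hR 1 one_pos le_rfl⟩
  obtain ⟨y, hy, hmin⟩ := LowerSemicontinuousOn.exists_isMinOn ⟨1, h1⟩ isCompact_Icc
    ((lowerSemicontinuousOn_xi γ).mono hsub)
  refine ⟨y, hsub hy, fun z (hz : 0 < z) => ?_⟩
  change xi γ y ≤ xi γ z
  rcases le_total (xi γ z) (xi γ 1) with h | h
  · exact hmin ⟨exp_le_of_xi_le hγ hz h, hR z hz h⟩
  · exact (hmin h1).trans h

/-- Existence of a minimizer excludes the default infimum 0, and the blow-up of `xi` at 0 keeps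
minimizers away from 0. Positivity suffices afterwards, as `xi_lower_bound` holds at every y > 0. -/
lemma yMin_pos {γ : ℝ} (hγ : 0 < (1 - γ) / γ) : 0 < yMin γ := by
  obtain ⟨y₀, hy₀⟩ := exists_isMinOn_xi hγ
  have hlow : Real.exp (-xi γ 1 - 1) ≤ yMin γ :=
    le_csInf ⟨y₀, hy₀⟩ fun y hy => exp_le_of_xi_le hγ hy.1 (hy.2 (mem_Ioi.2 one_pos))
  exact (Real.exp_pos _).trans_le hlow

lemma one_sub_gammaPrime_div_gammaPrime {C ρ δ ν : ℝ} (hC : C ≠ 0) (hk : ρ * δ ≠ 0)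
    (hden : (C ^ 2 - 1) * (ρ * δ) + ν ≠ 0) :
    (1 - gammaPrime C ρ δ ν) / gammaPrime C ρ δ ν = (ν - ρ * δ) / (C ^ 2 * (ρ * δ)) := by
  unfold gammaPrime
  generalize ρ * δ = k at *
  obtain ⟨d, hd⟩ : ∃ d, d = (C ^ 2 - 1) * k + ν := ⟨_, rfl⟩
  have h : (C ^ 2 - 1) / C ^ 2 * k + ν / C ^ 2 = d / C ^ 2 := by rw [hd]; ring
  have hν : ν = d - (C ^ 2 - 1) * k := by rw [hd]; ring
  rw [← hd] at hden
  rw [h, hν]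
  field_simp
  ring

lemma psiInt_lower_bound {C ρ δ ν : ℝ} (hC : 1 < C) (hk : 0 < ρ * δ) (hkν : ρ * δ < ν) :
    (ν - ρ * δ) * (Real.log ((ν - ρ * δ) / (C ^ 2 * (ρ * δ))) / 2) ≤ psiInt C ρ δ ν := by
  have hC2 : 1 < C ^ 2 := one_lt_pow₀ hC two_ne_zero
  have hm : 0 < ν - ρ * δ := sub_pos.2 hkν
  have hden : 0 < (C ^ 2 - 1) * (ρ * δ) + ν := by
    have := mul_pos (sub_pos.2 hC2) hk
    linarith
  have ha := one_sub_gammaPrime_div_gammaPrime (by positivity) hk.ne' hden.ne'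
  have hγ : 0 < (1 - gammaPrime C ρ δ ν) / gammaPrime C ρ δ ν := by
    rw [ha]
    positivity
  have h1 := xi_lower_bound hγ (yMin_pos hγ)
  rw [ha] at h1
  unfold psiInt
  nlinarith [mul_le_mul_of_nonneg_right h1 hm.le,
    mul_le_mul_of_nonneg_right Real.log_two_gt_d9.le hm.le]

/-! ### The combinatorial exponent -/

lemma H_eq (p : ℝ) : H p = Real.negMulLog p + Real.negMulLog (1 - p) :=
  Real.binEntropy_eq_negMulLog_add_negMulLog_one_sub p

lemma H_le {p : ℝ} (hp : p ≤ 1) : H p ≤ Real.negMulLog p + p := by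
  rw [H_eq]
  linarith [Real.negMulLog_le_one_sub_self (sub_nonneg.2 hp)]

lemma negMulLog_le_add_negMulLog {m ν : ℝ} (hm : 0 < m) (hmν : m ≤ ν) (hν : ν ≤ 1) :
    Real.negMulLog m ≤ ν - m + Real.negMulLog ν := by
  have hν0 : 0 < ν := hm.trans_le hmν
  have h1 := Real.log_le_sub_one_of_pos (div_pos hν0 hm)
  rw [Real.log_div hν0.ne' hm.ne'] at h1
  have h2 : m * (Real.log ν - Real.log m) ≤ ν - m := by
    calc _ ≤ m * (ν / m - 1) := mul_le_mul_of_nonneg_left h1 hm.le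
      _ = ν - m := by field_simp
  have h3 : m * -Real.log ν ≤ ν * -Real.log ν :=
    mul_le_mul_of_nonneg_right hmν (neg_nonneg.2 (Real.log_nonpos hν0.le hν))
  unfold Real.negMulLog
  linarith

lemma H_div_mul_le {k ν : ℝ} (hk : 0 ≤ k) (hkν : k < ν) (hν : ν ≤ 1) :
    H ((ν - k) / (1 - k)) * (1 - k) ≤ ν + Real.negMulLog ν := by
  have hm : 0 < ν - k := sub_pos.2 hkν
  have hk1 : 0 < 1 - k := by linarith
  have h1 := mul_le_mul_of_nonneg_right
    (H_le ((div_le_one hk1).2 (by linarith : ν - k ≤ 1 - k))) hk1.le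
  have h2 := negMulLog_le_add_negMulLog hm (by linarith) hν
  have h3 : Real.negMulLog ((ν - k) / (1 - k)) * (1 - k)
      = Real.negMulLog (ν - k) + (ν - k) * Real.log (1 - k) := by
    unfold Real.negMulLog
    rw [Real.log_div hm.ne' hk1.ne']
    field_simp
    ring
  have h4 : (ν - k) / (1 - k) * (1 - k) = ν - k := by field_simp
  have h5 : (ν - k) * Real.log (1 - k) ≤ 0 :=
    mul_nonpos_of_nonneg_of_nonpos hm.le (Real.log_nonpos hk1.le (by linarith))
  rw [add_mul, h3, h4] at h1
  linarith

lemma H_mul_le {ρ δ : ℝ} (hρ : 0 < ρ) (hρ1 : ρ ≤ 1) (hδ : 0 < δ) (hδ1 : δ ≤ 1)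
    (h : ρ * -Real.log δ ≤ 1) : H (ρ * δ) ≤ 3 * δ := by
  have h1 := H_le (mul_le_one₀ hρ1 hδ.le hδ1)
  have h2 := Real.negMulLog_le_one_sub_self hρ.le
  have h3 : Real.negMulLog (ρ * δ) = δ * Real.negMulLog ρ + δ * (ρ * -Real.log δ) := by
    unfold Real.negMulLog
    rw [Real.log_mul hρ.ne' hδ.ne']
    ring
  rw [h3] at h1
  nlinarith [mul_le_mul_of_nonneg_left h hδ.le, mul_le_mul_of_nonneg_left h2 hδ.le,
    mul_pos hρ hδ, mul_le_mul_of_nonneg_right hρ1 hδ.le]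

lemma psiCom_upper_bound {ρ δ ν : ℝ} (hρ : 0 < ρ) (hρ1 : ρ < 1) (hδ : 0 < δ)
    (hν : ν ∈ Icc δ 1) (h : ρ * -Real.log δ ≤ 1) :
    psiCom ρ δ ν ≤ 5 * ν + Real.negMulLog ν := by
  have hδ1 := hν.1.trans hν.2
  have hν0 : 0 < ν := hδ.trans_le hν.1
  have hk : ρ * δ < ν := (mul_lt_of_lt_one_left hδ hρ1).trans_le hν.1
  have h1 := H_mul_le hρ hρ1.le hδ hδ1 h
  have h2 := H_div_mul_le (mul_pos hρ hδ).le hk hν.2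
  unfold psiCom
  nlinarith [hν.1, mul_le_mul_of_nonneg_left Real.log_two_lt_d9.le hν0.le]

/-! ### The net exponent -/

lemma psiInt_ge_of_two_mul_le_one {C ρ δ ν : ℝ} (hC : 1 < C) (hρ : 0 < ρ) (hδ : 0 < δ)
    (hν : ν ∈ Icc δ 1) (hCρ : 2 * C ^ 2 * ρ ≤ 1) :
    ν * ((-Real.log ρ - 1 - Real.log (2 * C ^ 2)) / 2) ≤ psiInt C ρ δ ν := by
  have hC2 : 1 < C ^ 2 := one_lt_pow₀ hC two_ne_zero
  have hν0 : 0 < ν := hδ.trans_le hν.1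
  have hρ2 : ρ ≤ 1 / 2 := by nlinarith
  have hk : 0 < ρ * δ := mul_pos hρ hδ
  have hkν : ρ * δ ≤ ρ * ν := mul_le_mul_of_nonneg_left hν.1 hρ.le
  have hm : (1 - ρ) * ν ≤ ν - ρ * δ := by linarith
  have hmhalf : ν / 2 ≤ ν - ρ * δ := by nlinarith
  have hI := psiInt_lower_bound hC hk (by linarith : ρ * δ < ν)
  have hlog : -Real.log ρ - Real.log (2 * C ^ 2)
      ≤ Real.log ((ν - ρ * δ) / (C ^ 2 * (ρ * δ))) := by
    have e : -Real.log ρ - Real.log (2 * C ^ 2) = Real.log (1 / (2 * C ^ 2 * ρ)) := by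
      rw [one_div, Real.log_inv, Real.log_mul (by positivity) hρ.ne']
      ring
    rw [e]
    refine Real.log_le_log (by positivity) ?_
    rw [div_le_div_iff₀ (by positivity) (by positivity)]
    have hP : 0 < C ^ 2 * ρ := by positivity
    nlinarith [mul_le_mul_of_nonneg_left (hν.1.trans (by linarith : ν ≤ 2 * (ν - ρ * δ))) hP.le]
  have hnn : 0 ≤ -Real.log ρ - Real.log (2 * C ^ 2) := by
    have := Real.log_nonpos (by positivity) hCρ
    rw [Real.log_mul (by positivity) hρ.ne'] at this
    linarith
  have hA : 0 ≤ Real.log (2 * C ^ 2) := Real.log_nonneg (by linarith)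
  have hent := Real.negMulLog_le_one_sub_self hρ.le
  have h1 : (1 - ρ) * ν * ((-Real.log ρ - Real.log (2 * C ^ 2)) / 2)
      ≤ (ν - ρ * δ) * (Real.log ((ν - ρ * δ) / (C ^ 2 * (ρ * δ))) / 2) :=
    mul_le_mul hm (by linarith) (by linarith) (by linarith)
  have h2 : -Real.log ρ - 1 - Real.log (2 * C ^ 2)
      ≤ (1 - ρ) * (-Real.log ρ - Real.log (2 * C ^ 2)) := by
    unfold Real.negMulLog at hent
    nlinarith [mul_nonneg hρ.le hA]
  nlinarith [mul_le_mul_of_nonneg_left h2 hν0.le]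

lemma psiNet_psiExt_neg {C ρ δ ν : ℝ} (hC : 1 < C) (hρ : 0 < ρ) (hδ : 0 < δ)
    (hν : ν ∈ Icc δ 1) (hCρ : 2 * C ^ 2 * ρ ≤ 1) (hℓ : 1 ≤ -Real.log δ)
    (hρℓ : ρ * -Real.log δ ≤ 1)
    (hneg : 5 + Real.log (2 * √Real.pi * C ^ 2) + Real.log (-Real.log δ) / 2
      < (-Real.log ρ - 1 - Real.log (2 * C ^ 2)) / 2) :
    psiNet psiExt C ρ δ ν < 0 := by
  have hC2 : 1 < C ^ 2 := one_lt_pow₀ hC two_ne_zero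
  have hν0 : 0 < ν := hδ.trans_le hν.1
  have hρ1 : ρ < 1 := by nlinarith
  have h1 := psiCom_upper_bound hρ hρ1 hδ hν hρℓ
  have h2 := psiInt_ge_of_two_mul_le_one hC hρ hδ hν hCρ
  have h3 := psiExt_lower_bound hC hδ hρ.le hρ1.le hν hℓ
    (neg_le_neg (Real.log_le_log hδ hν.1))
  have h4 := mul_lt_mul_of_pos_left hneg hν0
  unfold psiNet
  unfold Real.negMulLog at h1
  linarith

lemma le_rhoN {ext : ℝ → ℝ → ℝ → ℝ → ℝ} {C ρ δ : ℝ} (hρ : ρ ∈ Icc (0 : ℝ) 1)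
    (h : ∀ ν ∈ Icc δ 1, psiNet ext C ρ δ ν < 0) : ρ ≤ rhoN ext δ C :=
  le_csSup ⟨1, fun _ hr => hr.1.2⟩ ⟨hρ, h⟩

end NetExponent

open NetExponent in
theorem lemma5 (η C : ℝ) (hη : 0 < η) (hC : 1 < C) :
    ∀ᶠ δ : ℝ in 𝓝[>] 0,
      Real.log (1 / δ) ^ (-(1 + η)) ≤ NetExponent.rhoN NetExponent.psiExt δ C ∧
      Real.log (1 / δ) ^ (-(1 + η)) ≤ NetExponent.rhoN NetExponent.psiExtMin δ C := by
  have hC2 : 1 < C ^ 2 := one_lt_pow₀ hC two_ne_zero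
  have hlim : Tendsto (fun δ : ℝ => -Real.log δ) (𝓝[>] 0) atTop :=
    tendsto_neg_atBot_atTop.comp Real.tendsto_log_nhdsGT_zero
  have hlim2 : Tendsto (fun δ : ℝ => η * Real.log (-Real.log δ)) (𝓝[>] 0) atTop :=
    (Real.tendsto_log_atTop.comp hlim).const_mul_atTop hη
  filter_upwards [self_mem_nhdsWithin, hlim.eventually_ge_atTop 1,
    hlim2.eventually_gt_atTop
      (11 + 2 * Real.log (2 * √Real.pi * C ^ 2) + Real.log (2 * C ^ 2))] with δ hδ hℓ hlarge
  replace hδ : 0 < δ := hδ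
  rw [one_div, Real.log_inv]
  set ℓ := -Real.log δ with hℓdef
  have hℓ0 : 0 < ℓ := by linarith
  set ρ := ℓ ^ (-(1 + η)) with hρdef
  have hρ : 0 < ρ := Real.rpow_pos_of_pos hℓ0 _
  have hlogρ : Real.log ρ = -(1 + η) * Real.log ℓ := Real.log_rpow hℓ0 _
  have hlogℓ : 0 ≤ Real.log ℓ := Real.log_nonneg hℓ
  have hB : 0 ≤ Real.log (2 * √Real.pi * C ^ 2) := by
    refine Real.log_nonneg ?_
    have : 1 ≤ √Real.pi * C ^ 2 := one_le_mul_of_one_le_of_one_le one_le_sqrt_pi hC2.le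
    linarith
  have hCρ : 2 * C ^ 2 * ρ ≤ 1 := by
    rw [← Real.log_nonpos_iff (by positivity), Real.log_mul (by positivity) hρ.ne', hlogρ]
    linarith
  have hρℓ : ρ * ℓ ≤ 1 := by
    rw [← Real.log_nonpos_iff (by positivity), Real.log_mul hρ.ne' hℓ0.ne', hlogρ]
    linarith [mul_nonneg hη.le hlogℓ]
  have hρ1 : ρ ∈ Icc (0 : ℝ) 1 := ⟨hρ.le, by nlinarith⟩
  have hnet : ∀ ν ∈ Icc δ 1, psiNet psiExt C ρ δ ν < 0 := fun ν hν =>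
    psiNet_psiExt_neg hC hρ hδ hν hCρ hℓ hρℓ (by
      rw [hlogρ]
      linarith)
  refine ⟨le_rhoN hρ1 hnet, le_rhoN hρ1 fun ν hν => lt_of_le_of_lt ?_ (hnet ν hν)⟩
  exact sub_le_sub_left (psiExt_le_psiExtMin hC hδ.le hρ.le) _
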